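/- Let $T$ be a strongly minimal theory in a countable first-order language, i.e. a complete theory all of whose models are infinite and such that in every model each subset of the universe definable with parameters is finite or cofinite. The pregeometry of $T$ is $(S,\operatorname{acl})$, where $S$ is the countable saturated model of $T$. In a pregeometry $(X,\operatorname{cl})$, $\dim(A)$ denotes the cardinality of any basis of $A\subseteq X$ (a minimal $Y\subseteq A$ with $A\subseteq\operatorname{cl}(Y)$). A pregeometry is *disintegrated* if whenever $b\in\operatorname{cl}(A)$ with $A\neq\emptyset$, then $b\in\operatorname{cl}(\{a\})$ for some $a\in A$. It is *flat* if it is not disintegrated and for every finite collection $E_1,\dots,E_k$ of finite-dimensional closed sets $$\dim\Big(\bigcup_{i} E_i\Big)\;\le\;\sum_{\emptyset\ne s\subseteq\{1,\dots,k\}}(-1)^{|s|+1}\dim\Big(\bigcap_{i\in s}E_i\Big).$$ A *circuit* is a dependent tuple every proper subtuple of which is independent; a circuit of size $m$ has dimension $m-1$. Suppose that the pregeometry of $T$ is flat and that the smallest circuit of size $>2$ in it has dimension $n=3$ (i.e. has size $4$). Then the prime model of $T$ (a model which embeds elementarily into every model of $T$) has dimension $p\ge 3$ (with respect to $\operatorname{acl}$);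 moreover $T$ has no model of dimension $2$. -/

import Mathlib

open FirstOrder

universe u v w

/-! ### Geometry of a closure operator

The notions below are stated for an operator `cl : Set X → Set X`; they are applied to the
algebraic closure operator of a strongly minimal structure, which is a pregeometry. -/

namespace Pregeom

variable {X : Type w} (cl : Set X → Set X)

/-- `A` is closed. -/
def IsClosedSet (A : Set X) : Prop := cl A = A

/-- A tuple is independent if no entry depends on the other entries
(so a tuple with a repeated entry is dependent). -/
def IndepTuple {ι : Type*} (a : ι → X) : Prop :=
  ∀ i, a i ∉ cl (a '' {j | j ≠ i})

/-- A basis for `A` is a minimal `Y ⊆ A` such that `A ⊆ cl Y`. -/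
def IsBasisFor (A Y : Set X) : Prop :=
  Minimal (fun Z : Set X => Z ⊆ A ∧ A ⊆ cl Z) Y

/-- The dimension of `A`: the cardinality of a basis for `A` (all bases of a set in a pregeometry
have the same cardinality, so the infimum is their common value), with all infinite values
identified with `⊤`. -/
noncomputable def dim (A : Set X) : ℕ∞ :=
  ⨅ Y ∈ {Y : Set X | IsBasisFor cl A Y}, Y.encard

/-- Disintegrated: whatever depends on a nonempty set depends on a single element of it. -/
def Disintegrated : Prop :=
  ∀ A : Set X, A.Nonempty → ∀ b ∈ cl A, ∃ a ∈ A, b ∈ cl {a}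

/-- The alternating sum
`∑_{∅ ≠ s ⊆ {1, …, k}} (-1)^(|s|+1) dim (⋂_{i ∈ s} E i)`, for finite-dimensional closed `E i`. -/
noncomputable def flatSum {k : ℕ} (E : Fin k → Set X) : ℤ :=
  ∑ s : Finset (Fin k) with s.Nonempty,
    (-1 : ℤ) ^ (s.card + 1) * ((dim cl (⋂ i ∈ s, E i)).toNat : ℤ)

/-- Flat: non-disintegrated, and for every finite collection of finite-dimensional closed sets the
alternating sum of dimensions of intersections is at least the dimension of the union. -/
def Flat : Prop :=
  ¬ Disintegrated cl ∧
    ∀ (k : ℕ) (E : Fin k → Set X), (∀ i, IsClosedSet cl (E i) ∧ dim cl (E i) ≠ ⊤) →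
      ((dim cl (⋃ i, E i)).toNat : ℤ) ≤ flatSum cl E

/-- A circuit: a dependent tuple all of whose proper subtuples are independent. -/
def IsCircuit {m : ℕ} (a : Fin m → X) : Prop :=
  ¬ IndepTuple cl a ∧
    ∀ s : Set (Fin m), s ≠ Set.univ → IndepTuple cl (fun i : s => a i)

/-- The smallest circuit of size `> 2` exists and has size `n + 1`, i.e. has dimension `n`. -/
def SmallestCircuitDim (n : ℕ) : Prop :=
  IsLeast {m : ℕ | 2 < m ∧ ∃ a : Fin m → X, IsCircuit cl a} (n + 1)

end Pregeom

/-! ### Strongly minimal theories -/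

namespace StrMin

/-- Algebraic closure in `M`: the elements of finite `A`-definable subsets of `M`. -/
def acl (L : FirstOrder.Language.{u, v}) {M : Type w} [L.Structure M] (A : Set M) : Set M :=
  {x | ∃ s : Set M, A.Definable₁ L s ∧ s.Finite ∧ x ∈ s}

/-- The dimension of a structure with respect to algebraic closure. -/
noncomputable def modelDim (L : FirstOrder.Language.{u, v}) (M : Type w) [L.Structure M] : ℕ∞ :=
  Pregeom.dim (acl L) (Set.univ : Set M)

/-- `T` is strongly minimal: `T` is a complete theory, its models are infinite, and in each of them
every subset definable with parameters is finite or cofinite. -/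
def IsStronglyMinimal {L : FirstOrder.Language.{u, v}} (T : L.Theory) : Prop :=
  T.IsComplete ∧
    ∀ (M : Type w) [L.Structure M] [M ⊨ T], Infinite M ∧
      ∀ s : Set M, (Set.univ : Set M).Definable₁ L s → s.Finite ∨ sᶜ.Finite

/-- `M` realizes every partial `1`-type over every finite set of parameters. For countably infinite
`M`, this says that `M` is saturated. -/
def IsOmegaSaturated (L : FirstOrder.Language.{u, v}) (M : Type w) [L.Structure M] : Prop :=
  ∀ A : Set M, A.Finite → ∀ p : Set (L[[A]].Formula (Fin 1)),
    (∀ q ⊆ p, q.Finite → ∃ x : M, ∀ φ ∈ q, φ.Realize fun _ => x) →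
      ∃ x : M, ∀ φ ∈ p, φ.Realize fun _ => x

/-- A prime model of `T`: a model that embeds elementarily into every model of `T`. -/
def IsPrimeModel {L : FirstOrder.Language.{u, v}} (T : L.Theory) (P : Type w) [L.Structure P] : Prop :=
  P ⊨ T ∧ ∀ (N : Type w) [L.Structure N] [N ⊨ T], Nonempty (P ↪ₑ[L] N)

end StrMin

/-! Suppose some model is the algebraic closure of two points. It is infinite, so by completeness
the closures of pairs in S have unbounded size. Without circuits of size three, acl(s, t) = acl(s) ∪
acl(t), and a generic point has the largest closure among points; hence acl(a) is infinite for
generic a. Flatness forbids this once a circuit of size four exists.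

Let Q(a, b, c, d) be a parameter-free definable relation that holds at a 4-circuit and forces each
coordinate to be algebraic over the other three. Take a, a', c, c' independent. For all but finitely
many of the infinitely many b in acl(a), Q(a, b, c, d) and Q(a, b, c', d') have solutions with d in
acl(c) and d' in acl(c'). Then a and a' have the same type over c, d, c', d', so some b' can play
with a' the role that b plays with a. The set of b for which such d, d', b' exist is definable and
infinite, hence cofinite, and so contains a b generic over a, a', c, c'. This is
`IsMinimal.exists_grid`.

The result is a 2 × 2 grid: the pairs ab, a'b' are each joined by a dependent quadruple to cd, c'd',
and the eight points have dimension at least 5. The four quadruples span closed sets of dimension at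
most 3; adjacent ones meet in dimension at least 2, and any three meet in cl ∅. The alternating sum
is thus at most 12 - 8 = 4 < 5, against flatness (`Grid.not_flat`). -/

namespace StrMin

open Set FirstOrder.Language

/-! ### Definable relations and counting quantifiers -/

section Definability

variable {L : FirstOrder.Language.{u, v}} {M : Type w} [L.Structure M] {α β : Type} {A B : Set M}

/-- Prepend a value to a valuation. -/
def cons (x : M) (v : α → M) : Option α → M := fun o => o.elim x v

@[simp] theorem cons_none (x : M) (v : α → M) : cons x v none = x := rfl

@[simp] theorem cons_some (x : M) (v : α → M) (i : α) : cons x v (some i) = v i := rfl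

/-- The formula does not depend on the structure, which is what later lets a sentence pass from one
model to another. -/
theorem exists_formula_ex (φ : L.Formula (Option α)) :
    ∃ ψ : L.Formula α, ∀ (N : Type w) [L.Structure N] (v : α → N),
      ψ.Realize v ↔ ∃ x, φ.Realize (cons x v) := by
  refine ⟨(φ.relabel (fun o => o.elim (Sum.inr ()) Sum.inl : Option α → α ⊕ Unit)).iExs Unit,
    fun N _ v => ?_⟩
  rw [Formula.realize_iExs]
  have key : ∀ i : Unit → N, (Sum.elim v i ∘ fun o : Option α => o.elim (Sum.inr ()) Sum.inl) =
      cons (i ()) v := by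
    intro i
    funext o
    cases o <;> rfl
  constructor
  · rintro ⟨i, hi⟩
    exact ⟨i (), by rw [← key]; exact Formula.realize_relabel.1 hi⟩
  · rintro ⟨x, hx⟩
    exact ⟨fun _ => x, Formula.realize_relabel.2 (by rw [key]; exact hx)⟩

theorem succ_le_encard_iff {X : Type*} (s : Set X) (n : ℕ) :
    ((n + 1 : ℕ) : ℕ∞) ≤ s.encard ↔ ∃ x ∈ s, (n : ℕ∞) ≤ {y | y ∈ s ∧ y ≠ x}.encard := by
  have hs : ∀ x, {y | y ∈ s ∧ y ≠ x} = s \ {x} := fun x => by ext; simp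
  simp only [hs]
  constructor
  · intro h
    obtain ⟨x, hx⟩ : s.Nonempty := by
      rw [← encard_pos]
      exact lt_of_lt_of_le (by simp) h
    refine ⟨x, hx, ?_⟩
    rw [← encard_sdiff_singleton_add_one hx] at h
    push_cast at h
    exact (ENat.add_le_add_iff_right (by simp)).1 h
  · rintro ⟨x, hx, h⟩
    rw [← encard_sdiff_singleton_add_one hx]
    push_cast
    gcongr

/-- Counting is first-order: there are n + 1 solutions when some solution x leaves n solutions
different from x. The induction adds x to the free variables, so `α` must vary. -/
theorem exists_formula_le_encard (n : ℕ) : ∀ {α : Type} (φ : L.Formula (Option α)),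
    ∃ ψ : L.Formula α, ∀ (N : Type w) [L.Structure N] (v : α → N),
      ψ.Realize v ↔ (n : ℕ∞) ≤ {x | φ.Realize (cons x v)}.encard := by
  induction n with
  | zero => exact fun φ => ⟨⊤, fun N _ v => by simp⟩
  | succ n ih =>
    intro α φ
    let χ : L.Formula (Option (Option α)) :=
      φ.relabel (fun o => o.elim none fun i => some (some i)) ⊓
        ((Term.var none).equal (Term.var (some none)) : L.Formula (Option (Option α))).not
    obtain ⟨ψ, hψ⟩ := ih χ
    obtain ⟨θ, hθ⟩ := exists_formula_ex.{u, v, w} (φ ⊓ ψ)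
    refine ⟨θ, fun N _ v => ?_⟩
    rw [hθ, succ_le_encard_iff]
    refine exists_congr fun x => ?_
    rw [Formula.realize_inf, hψ]
    have : {y | χ.Realize (cons y (cons x v))} = {y | φ.Realize (cons y v) ∧ y ≠ x} := by
      ext y
      have e : (cons y (cons x v) ∘ fun o : Option α => o.elim none fun i => some (some i)) =
          cons y v := by
        funext o
        cases o <;> rfl
      simp [χ, Formula.realize_relabel, e]
    rw [this]
    rfl

/-- The relation `P` on valuations is definable over `A`. -/
def Dfn (L : FirstOrder.Language.{u, v}) {M : Type w} [L.Structure M] {α : Type} (A : Set M)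
    (P : (α → M) → Prop) : Prop :=
  A.Definable L {v | P v}

theorem Dfn.and {P Q : (α → M) → Prop} (hP : Dfn L A P) (hQ : Dfn L A Q) :
    Dfn L A fun v => P v ∧ Q v :=
  Definable.inter hP hQ

theorem Dfn.or {P Q : (α → M) → Prop} (hP : Dfn L A P) (hQ : Dfn L A Q) :
    Dfn L A fun v => P v ∨ Q v :=
  Definable.union hP hQ

theorem Dfn.not {P : (α → M) → Prop} (hP : Dfn L A P) : Dfn L A fun v => ¬ P v :=
  Definable.compl hP

theorem Dfn.comp {P : (α → M) → Prop} (hP : Dfn L A P) (f : α → β) :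
    Dfn L A fun v : β → M => P fun i => v (f i) :=
  Definable.preimage_comp f hP

theorem Dfn.mono {P : (α → M) → Prop} (hP : Dfn L A P) (h : A ⊆ B) : Dfn L B P :=
  Definable.mono hP h

theorem Dfn.ex {P : M → (α → M) → Prop}
    (h : Dfn L A fun w : Option α → M => P (w none) fun i => w (some i)) :
    Dfn L A fun v => ∃ x, P x v := by
  obtain ⟨φ, hφ⟩ := h
  obtain ⟨ψ, hψ⟩ := exists_formula_ex.{_, _, w} φ
  refine ⟨ψ, ?_⟩
  ext v
  rw [mem_ofPred_eq, mem_ofPred_eq, hψ]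
  refine exists_congr fun x => ?_
  have := Set.ext_iff.1 hφ (cons x v)
  exact this

theorem Dfn.le_encard {P : M → (α → M) → Prop}
    (h : Dfn L A fun w : Option α → M => P (w none) fun i => w (some i)) (n : ℕ) :
    Dfn L A fun v => (n : ℕ∞) ≤ {x | P x v}.encard := by
  obtain ⟨φ, hφ⟩ := h
  obtain ⟨ψ, hψ⟩ := exists_formula_le_encard.{_, _, w} n φ
  refine ⟨ψ, ?_⟩
  ext v
  rw [mem_ofPred_eq, mem_ofPred_eq, hψ]
  have : {x | P x v} = {x | φ.Realize (cons x v)} := by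
    ext x
    have := Set.ext_iff.1 hφ (cons x v)
    exact this
  rw [this]

theorem Dfn.encard_le {P : M → (α → M) → Prop}
    (h : Dfn L A fun w : Option α → M => P (w none) fun i => w (some i)) (n : ℕ) :
    Dfn L A fun v => {x | P x v}.encard ≤ n := by
  have := (h.le_encard (n + 1)).not
  simpa only [not_le, Nat.cast_add, Nat.cast_one, ENat.lt_add_one_iff (ENat.natCast_ne_top n)]
    using this

theorem Dfn.eq_const {a : M} (ha : a ∈ A) (i : α) : Dfn L A fun v : α → M => v i = a :=
  Dfn.comp (α := Fin 1) (P := fun v => v 0 = a)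
    (by
      refine ⟨(Term.var 0).equal (L.con (⟨a, ha⟩ : A)).term, ?_⟩
      ext v
      simp) fun _ => i

theorem Dfn.subst {P : M → (α → M) → Prop} {a : M} (ha : a ∈ A)
    (h : Dfn L A fun w : Option α → M => P (w none) fun i => w (some i)) :
    Dfn L A fun v => P a v := by
  have := Dfn.ex (P := fun x v => x = a ∧ P x v) ((Dfn.eq_const ha none).and h)
  simpa using this

/-- Turns one parameter into a variable, so that it can be quantified or moved by a type argument.
-/
theorem Dfn.exists_of_insert {P : (α → M) → Prop} {a : M} (h : Dfn L (insert a A) P) :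
    ∃ Q : M → (α → M) → Prop, (Dfn L A fun w : Option α → M => Q (w none) fun i => w (some i)) ∧
      ∀ v, P v ↔ Q a v := by
  classical
  obtain ⟨φ, hφ⟩ := definable_iff_exists_formula_sum.1 h
  let f : (insert a A : Set M) ⊕ α → A ⊕ Option α := Sum.elim
    (fun z => if hz : (z : M) ∈ A then Sum.inl ⟨z, hz⟩ else Sum.inr none) fun i => Sum.inr (some i)
  refine ⟨fun x v => (φ.relabel f).Realize (Sum.elim (fun z : A => (z : M)) (cons x v)), ?_, ?_⟩
  · refine definable_iff_exists_formula_sum.2 ⟨φ.relabel f, ?_⟩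
    ext w
    have : cons (w none) (fun i => w (some i)) = w := by
      funext o
      cases o <;> rfl
    simp [this]
  · intro v
    have : Sum.elim (fun z : A => (z : M)) (cons a v) ∘ f =
        Sum.elim (fun z : (insert a A : Set M) => (z : M)) v := by
      funext z
      rcases z with ⟨z, hz⟩ | i
      · by_cases hzA : z ∈ A
        · simp [f, hzA]
        · have hza : z = a := hz.resolve_right hzA
          subst hza
          simp [f, hzA]
      · simp [f]
    change P v ↔ (φ.relabel f).Realize _
    rw [Formula.realize_relabel, this]
    exact Set.ext_iff.1 hφ v

theorem Dfn.exists_finite {P : (α → M) → Prop} (h : Dfn L A P) :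
    ∃ F ⊆ A, F.Finite ∧ Dfn L F P := by
  obtain ⟨F, hF, h⟩ := definable_iff_finitely_definable.1 h
  exact ⟨F, hF, F.finite_toSet, h⟩

end Definability

/-! ### Algebraic closure in a minimal structure is a pregeometry -/

section Acl

variable {L : FirstOrder.Language.{u, v}} {M : Type w} [L.Structure M] {A B : Set M} {x y : M}

theorem mem_acl : x ∈ acl L A ↔
    ∃ P : M → Prop, (Dfn L A fun v : Fin 1 → M => P (v 0)) ∧ {x | P x}.Finite ∧ P x :=
  Iff.rfl

theorem mem_acl_of_finite {P : M → Prop} (hP : Dfn L A fun v : Fin 1 → M => P (v 0))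
    (hf : {x | P x}.Finite) (hx : P x) : x ∈ acl L A :=
  mem_acl.2 ⟨P, hP, hf, hx⟩

theorem acl_mono (h : A ⊆ B) : acl L A ⊆ acl L B := by
  intro x hx
  obtain ⟨P, hP, hf, hx⟩ := mem_acl.1 hx
  exact mem_acl_of_finite (hP.mono h) hf hx

theorem subset_acl (A : Set M) : A ⊆ acl L A := fun x hx =>
  mem_acl_of_finite (P := fun y => y = x) (Dfn.eq_const hx 0) (by simp) rfl

/-- The union of the fibres of Q over the finite set P is definable over A and contains x. Fibres
over other points of P may be infinite; the clause bounding the fibre by n discards them. -/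
theorem mem_acl_of_mem_acl_insert (hy : y ∈ acl L A) (hx : x ∈ acl L (insert y A)) :
    x ∈ acl L A := by
  obtain ⟨P, hP, hPf, hPy⟩ := mem_acl.1 hy
  obtain ⟨R, hR, hRf, hRx⟩ := mem_acl.1 hx
  obtain ⟨Q, hQ, hRQ⟩ := hR.exists_of_insert
  have hRQ' : ∀ z, R z ↔ Q y fun _ => z := fun z => hRQ fun _ => z
  obtain ⟨n, hn⟩ : ∃ n : ℕ, {z | Q y fun _ => z}.encard = n := by
    simp only [hRQ'] at hRf
    exact ⟨_, hRf.encard_eq_coe_toFinset_card⟩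
  have hb : Dfn L A fun w : Fin 1 → M => {z | Q (w 0) fun _ => z}.encard ≤ n :=
    Dfn.encard_le (P := fun z w => Q (w 0) fun _ => z)
      (hQ.comp fun o => o.elim (some 0) fun _ => none) n
  refine mem_acl_of_finite
    (P := fun x => ∃ y, P y ∧ (Q y fun _ => x) ∧ {z | Q y fun _ => z}.encard ≤ n) ?_ ?_
    ⟨y, hPy, (hRQ' x).1 hRx, hn.le⟩
  · exact Dfn.ex (P := fun y v => P y ∧ (Q y fun _ => v 0) ∧ {z | Q y fun _ => z}.encard ≤ n)
      ((hP.comp fun _ => none).and ((hQ.comp fun o => o.elim none fun _ => some 0).and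
        (hb.comp fun _ => none)))
  · refine (hPf.biUnion (t := fun y => {x | (Q y fun _ => x) ∧ {z | Q y fun _ => z}.encard ≤ n})
      fun y _ => ?_).subset ?_
    · by_cases h : {z | Q y fun _ => z}.encard ≤ n
      · exact (finite_of_encard_le_coe h).subset fun z hz => hz.1
      · simp [h]
    · rintro x ⟨y, hy, h⟩
      exact mem_biUnion hy h

theorem acl_acl (A : Set M) : acl L (acl L A) = acl L A := by
  refine Subset.antisymm (fun x hx => ?_) (subset_acl _)
  obtain ⟨P, hP, hf, hx⟩ := mem_acl.1 hx
  obtain ⟨F, hFA, hF, hP⟩ := hP.exists_finite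
  have hx : x ∈ acl L (F ∪ A) := mem_acl_of_finite (hP.mono subset_union_left) hf hx
  clear hP
  induction F, hF using Set.Finite.induction_on with
  | empty => simpa using hx
  | insert _ _ ih =>
    rename_i y F _ _
    rw [insert_subset_iff] at hFA
    refine ih hFA.2 (mem_acl_of_mem_acl_insert (acl_mono subset_union_right hFA.1) ?_)
    rwa [insert_union] at hx

/-- Every subset of `M` definable with parameters is finite or cofinite, and `M` is infinite. -/
def IsMinimal (L : FirstOrder.Language.{u, v}) (M : Type w) [L.Structure M] : Prop :=
  Infinite M ∧ ∀ s : Set M, (Set.univ : Set M).Definable₁ L s → s.Finite ∨ sᶜ.Finite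

theorem IsMinimal.compl_finite (hM : IsMinimal L M) {P : M → Prop}
    (hP : Dfn L A fun v : Fin 1 → M => P (v 0)) (hx : x ∉ acl L A) (h : P x) :
    {x | ¬ P x}.Finite :=
  (hM.2 {x | P x} (hP.mono (subset_univ A))).resolve_left fun hf => hx (mem_acl_of_finite hP hf h)

/-- All points outside acl(A) have the same type over A. -/
theorem IsMinimal.transfer (hM : IsMinimal L M) {P : M → Prop}
    (hP : Dfn L A fun v : Fin 1 → M => P (v 0)) (hx : x ∉ acl L A) (h : P x) (hy : y ∉ acl L A) :
    P y := by
  by_contra hPy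
  exact hy (mem_acl_of_finite hP.not (hM.compl_finite hP hx h) hPy)

/-- Double counting. If y is generic over A and x, then Φ(·, x) fails at only m points. Since x is
not algebraic over A, infinitely many b share this bound. Some a satisfies Φ(a, b) for n + 1 of
them, while Φ allows a at most n. -/
theorem IsMinimal.exchange (hM : IsMinimal L M) (hx : x ∈ acl L (insert y A)) (hxA : x ∉ acl L A) :
    y ∈ acl L (insert x A) := by
  by_contra hy
  obtain ⟨R, hR, hRf, hRx⟩ := mem_acl.1 hx
  obtain ⟨Q, hQ, hRQ⟩ := hR.exists_of_insert
  have hRQ' : ∀ z, R z ↔ Q y fun _ => z := fun z => hRQ fun _ => z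
  obtain ⟨n, hn⟩ : ∃ n : ℕ, {z | Q y fun _ => z}.encard = n := by
    simp only [hRQ'] at hRf
    exact ⟨_, hRf.encard_eq_coe_toFinset_card⟩
  let Φ : M → M → Prop := fun a b => (Q a fun _ => b) ∧ {z | Q a fun _ => z}.encard ≤ n
  have hΦ : Dfn L A fun w : Fin 2 → M => Φ (w 0) (w 1) :=
    (hQ.comp fun o => o.elim 0 fun _ => 1).and
      (Dfn.encard_le (P := fun z w => Q (w 0) fun _ => z)
        (hQ.comp fun o => o.elim (some 0) fun _ => none) n)
  have hΦx : Dfn L (insert x A) fun w : Fin 1 → M => Φ (w 0) x :=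
    Dfn.subst (P := fun b w => Φ (w 0) b) (mem_insert x A)
      ((hΦ.comp ![some 0, none]).mono (subset_insert x A))
  have hfin := hM.compl_finite (P := fun a => Φ a x) hΦx hy ⟨(hRQ' x).1 hRx, hn.le⟩
  obtain ⟨m, hm⟩ : ∃ m : ℕ, {a | ¬ Φ a x}.encard = m := ⟨_, hfin.encard_eq_coe_toFinset_card⟩
  have hΨ : Dfn L A fun w : Fin 1 → M => {a | ¬ Φ a (w 0)}.encard ≤ m :=
    Dfn.encard_le (P := fun a w => ¬ Φ a (w 0)) (hΦ.comp ![none, some 0]).not m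
  have hinf : {b | {a | ¬ Φ a b}.encard ≤ m}.Infinite := fun hf =>
    hxA (mem_acl_of_finite (P := fun b => {a | ¬ Φ a b}.encard ≤ m) hΨ hf hm.le)
  obtain ⟨t, ht, htc⟩ := hinf.exists_subset_card_eq (n + 1)
  have : (⋃ b ∈ t, {a | ¬ Φ a b}).Finite :=
    t.finite_toSet.biUnion fun b hb => finite_of_encard_le_coe (ht hb)
  have := hM.1
  obtain ⟨a, ha⟩ := ‹(⋃ b ∈ t, {a | ¬ Φ a b}).Finite›.infinite_compl.nonempty
  have hat : ∀ b ∈ t, Φ a b := by simpa using ha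
  have h1 : (t : Set M) ⊆ {z | Q a fun _ => z} := fun b hb => (hat b hb).1
  have hne : t.Nonempty := by
    rw [← Finset.card_pos]
    omega
  obtain ⟨b, hb⟩ := hne
  have h2 := (encard_le_encard h1).trans (hat b hb).2
  rw [encard_coe_eq_coe_finsetCard, htc] at h2
  have h3 : n + 1 ≤ n := by exact_mod_cast h2
  omega

end Acl

end StrMin

/-! ### Dimension and the Steinitz replacement argument -/

namespace Pregeom

open Set

/-- `cl` is a closure operator with the exchange property. -/
structure IsPregeom {X : Type w} (cl : Set X → Set X) : Prop where
  mono : ∀ {A B : Set X}, A ⊆ B → cl A ⊆ cl B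
  subset : ∀ A : Set X, A ⊆ cl A
  idem : ∀ A : Set X, cl (cl A) = cl A
  exchange : ∀ {A : Set X} {x y : X}, x ∈ cl (insert y A) → x ∉ cl A → y ∈ cl (insert x A)

variable {X : Type w} {cl : Set X → Set X}

theorem exists_isBasisFor {A Y : Set X} (hY : Y.Finite) (hYA : Y ⊆ A) (hA : A ⊆ cl Y) :
    ∃ Z ⊆ Y, IsBasisFor cl A Z := by
  have hfin : {Z : Set X | Z ⊆ Y ∧ A ⊆ cl Z}.Finite :=
    hY.finite_subsets.subset fun Z hZ => hZ.1
  obtain ⟨Z, hZ⟩ := hfin.exists_minimal ⟨Y, Subset.rfl, hA⟩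
  refine ⟨Z, hZ.prop.1, ⟨hZ.prop.1.trans hYA, hZ.prop.2⟩, fun W hW hWZ => ?_⟩
  exact hZ.le_of_le ⟨hWZ.trans hZ.prop.1, hW.2⟩ hWZ

theorem dim_le_encard {A Y : Set X} (hY : Y.Finite) (hYA : Y ⊆ A) (hA : A ⊆ cl Y) :
    dim cl A ≤ Y.encard := by
  obtain ⟨Z, hZY, hZ⟩ := exists_isBasisFor hY hYA hA
  exact (iInf₂_le Z hZ).trans (encard_le_encard hZY)

/-- With `dim_le_encard`, this gives all needed bounds on `dim` without knowing that bases have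
equal cardinality. -/
theorem le_dim {A : Set X} {n : ℕ∞} (h : ∀ Y, A ⊆ cl Y → n ≤ Y.encard) : n ≤ dim cl A :=
  le_iInf₂ fun Y hY => h Y (Minimal.prop (show IsBasisFor cl A Y from hY)).2

namespace IsPregeom

variable (h : IsPregeom cl)
include h

theorem cl_subset {A B : Set X} (hAB : A ⊆ cl B) : cl A ⊆ cl B :=
  (h.mono hAB).trans (h.idem B).subset

theorem exists_exchange {B Y : Set X} {x : X} (hY : Y.Finite) (hx : x ∈ cl (B ∪ Y))
    (hxB : x ∉ cl B) : ∃ y ∈ Y, y ∈ cl (insert x B ∪ (Y \ {y})) := by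
  induction Y, hY using Set.Finite.induction_on with
  | empty => simp [hxB] at hx
  | @insert y Y hy _ ih =>
    by_cases hx' : x ∈ cl (B ∪ Y)
    · obtain ⟨z, hz, hzc⟩ := ih hx'
      refine ⟨z, Or.inr hz, h.mono ?_ hzc⟩
      gcongr
      exact subset_insert y Y
    · rw [union_insert] at hx
      refine ⟨y, Set.mem_insert y Y, h.mono ?_ (h.exchange hx hx')⟩
      rw [insert_union, insert_sdiff_of_mem _ (mem_singleton y), sdiff_singleton_eq_self hy]

/-- A list is independent over `B` if no entry depends on `B` and the previous entries. -/
def _root_.Pregeom.IndepList (cl : Set X → Set X) : Set X → List X → Prop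
  | _, [] => True
  | B, x :: l => x ∉ cl B ∧ IndepList cl (insert x B) l

theorem length_le_encard (l : List X) : ∀ {B Y : Set X}, IndepList cl B l →
    (∀ x ∈ l, x ∈ cl (B ∪ Y)) → (l.length : ℕ∞) ≤ Y.encard := by
  induction l with
  | nil => simp
  | cons x l ih =>
    intro B Y hl hY
    by_cases hfin : Y.Finite
    · obtain ⟨y, hy, hyc⟩ := h.exists_exchange hfin (hY x (by simp)) hl.1
      have hsub : B ∪ Y ⊆ cl (insert x B ∪ (Y \ {y})) := by
        intro z hz
        by_cases hzy : z = y
        · rwa [hzy]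
        · refine h.subset _ ?_
          rcases hz with hz | hz
          · exact Or.inl (Or.inr hz)
          · exact Or.inr ⟨hz, hzy⟩
      have := ih hl.2 fun z hz => h.cl_subset hsub (hY z (by simp [hz]))
      rw [← encard_sdiff_singleton_add_one hy]
      simpa using this
    · simp [Set.Infinite.encard_eq hfin]

theorem toNat_dim_le_three (a b c : X) : (dim cl (cl {a, b, c})).toNat ≤ 3 := by
  have := dim_le_encard (cl := cl) (A := cl {a, b, c}) (Y := {a, b, c}) (toFinite _) (h.subset _)
    Subset.rfl
  refine ENat.toNat_le_of_le_natCast (this.trans ?_)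
  refine (encard_insert_le _ _).trans ?_
  refine (add_le_add_left (encard_insert_le _ _) 1).trans ?_
  simp
  norm_num

end IsPregeom

/-! ### Grids, and why flatness excludes them -/

theorem mem_congr {A B : Set X} {x : X} (hAB : A = B) (hx : x ∈ cl A) : x ∈ cl B :=
  hAB ▸ hx

/-- Each of the four points depends on the other three. -/
structure Edge (cl : Set X → Set X) (a b c d : X) : Prop where
  mem₁ : a ∈ cl {b, c, d}
  mem₂ : b ∈ cl {a, c, d}
  mem₃ : c ∈ cl {a, b, d}
  mem₄ : d ∈ cl {a, b, c}

/-- Two pairs `(a, b)`, `(a', b')` and two pairs `(c, d)`, `(c', d')` such that each of the first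
forms a dependent quadruple with each of the second, and the eight points are not spanned by
four points. -/
structure Grid (cl : Set X → Set X) (a b a' b' c d c' d' : X) : Prop where
  e₁₁ : Edge cl a b c d
  e₁₂ : Edge cl a b c' d'
  e₂₁ : Edge cl a' b' c d
  e₂₂ : Edge cl a' b' c' d'
  not_span : ∀ p q r s, ¬ ({a, b, a', b', c, d, c', d'} : Set X) ⊆ cl {p, q, r, s}

theorem Edge.swap {a b c d : X} (e : Edge cl a b c d) : Edge cl c d a b where
  mem₁ := mem_congr (by ext; simp only [mem_insert_iff, mem_singleton_iff]; tauto) e.mem₃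
  mem₂ := mem_congr (by ext; simp only [mem_insert_iff, mem_singleton_iff]; tauto) e.mem₄
  mem₃ := mem_congr (by ext; simp only [mem_insert_iff, mem_singleton_iff]; tauto) e.mem₁
  mem₄ := mem_congr (by ext; simp only [mem_insert_iff, mem_singleton_iff]; tauto) e.mem₂

theorem Edge.flip {a b c d : X} (e : Edge cl a b c d) : Edge cl b a c d where
  mem₁ := e.mem₂
  mem₂ := e.mem₁
  mem₃ := mem_congr (by ext; simp only [mem_insert_iff, mem_singleton_iff]; tauto) e.mem₃
  mem₄ := mem_congr (by ext; simp only [mem_insert_iff, mem_singleton_iff]; tauto) e.mem₄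

namespace Grid

variable {a b a' b' c d c' d' : X}

theorem swap (g : Grid cl a b a' b' c d c' d') : Grid cl c d c' d' a b a' b' where
  e₁₁ := g.e₁₁.swap
  e₁₂ := g.e₂₁.swap
  e₂₁ := g.e₁₂.swap
  e₂₂ := g.e₂₂.swap
  not_span p q r s hs := g.not_span p q r s (by
    simp only [insert_subset_iff, singleton_subset_iff] at hs ⊢
    tauto)

theorem flip (g : Grid cl a b a' b' c d c' d') : Grid cl b a b' a' c d c' d' where
  e₁₁ := g.e₁₁.flip
  e₁₂ := g.e₁₂.flip
  e₂₁ := g.e₂₁.flip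
  e₂₂ := g.e₂₂.flip
  not_span p q r s hs := g.not_span p q r s (by
    simp only [insert_subset_iff, singleton_subset_iff] at hs ⊢
    tauto)

theorem symm₁ (g : Grid cl a b a' b' c d c' d') : Grid cl a' b' a b c d c' d' where
  e₁₁ := g.e₂₁
  e₁₂ := g.e₂₂
  e₂₁ := g.e₁₁
  e₂₂ := g.e₁₂
  not_span p q r s hs := g.not_span p q r s (by
    simp only [insert_subset_iff, singleton_subset_iff] at hs ⊢
    tauto)

theorem symm₂ (g : Grid cl a b a' b' c d c' d') : Grid cl a b a' b' c' d' c d where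
  e₁₁ := g.e₁₂
  e₁₂ := g.e₁₁
  e₂₁ := g.e₂₂
  e₂₂ := g.e₂₁
  not_span p q r s hs := g.not_span p q r s (by
    simp only [insert_subset_iff, singleton_subset_iff] at hs ⊢
    tauto)

variable (h : IsPregeom cl) (g : Grid cl a b a' b' c d c' d')
include h g

/-- The eight points of a grid are spanned by `a, b, c, a', c'`. -/
theorem subset_cl {F : Set X} (ha : a ∈ cl F) (hb : b ∈ cl F) (hc : c ∈ cl F) (ha' : a' ∈ cl F)
    (hc' : c' ∈ cl F) : {a, b, a', b', c, d, c', d'} ⊆ cl F := by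
  have tri : ∀ {x y z : X}, x ∈ cl F → y ∈ cl F → z ∈ cl F → cl {x, y, z} ⊆ cl F :=
    fun hx hy hz => h.cl_subset (by simp [insert_subset_iff, hx, hy, hz])
  have hd := tri ha hb hc g.e₁₁.mem₄
  have hd' := tri ha hb hc' g.e₁₂.mem₄
  have hb' := tri ha' hc hd g.e₂₁.mem₂
  simp [insert_subset_iff, ha, hb, hc, ha', hc', hd, hd', hb']

theorem not_mem {p q r s : X} (ha : a ∈ cl {p, q, r, s}) (hb : b ∈ cl {p, q, r, s})
    (hc : c ∈ cl {p, q, r, s}) (ha' : a' ∈ cl {p, q, r, s}) : c' ∉ cl {p, q, r, s} :=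
  fun hc' => g.not_span p q r s (g.subset_cl h ha hb hc ha' hc')

theorem notMem_third : c ∉ cl {a, b, c'} := fun hc =>
  g.not_mem h (p := a) (q := b) (r := c') (s := a') (h.subset _ (by simp)) (h.subset _ (by simp))
    (h.mono (by simp [insert_subset_iff]) hc) (h.subset _ (by simp)) (h.subset _ (by simp))

theorem inter_subset : cl {a, b, c} ∩ cl {a, b, c'} ⊆ cl {a, b} := by
  rintro x ⟨hx, hx'⟩
  by_contra hxab
  have h1 : c ∈ cl {x, a, b} := h.exchange (h.mono (by simp [insert_subset_iff]) hx) hxab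
  refine g.notMem_third h (h.cl_subset ?_ h1)
  simp only [insert_subset_iff, singleton_subset_iff]
  exact ⟨hx', h.subset _ (by simp), h.subset _ (by simp)⟩

theorem notMem_first : a ∉ cl {c} := fun ha =>
  g.not_mem h (p := c) (q := b) (r := a') (s := c') (h.mono (by simp) ha) (h.subset _ (by simp))
    (h.subset _ (by simp)) (h.subset _ (by simp)) (h.subset _ (by simp))

/-- Lets the span of an edge be read from either of its pairs, so that facts about rows of the grid
apply to columns through `swap`. -/
theorem cl_eq : cl {a, b, c} = cl {c, d, a} := by
  refine Subset.antisymm (h.cl_subset ?_) (h.cl_subset ?_)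
  · simp only [insert_subset_iff, singleton_subset_iff]
    exact ⟨h.subset _ (by simp), h.mono (by simp [insert_subset_iff]) g.e₁₁.mem₂, h.subset _ (by simp)⟩
  · simp only [insert_subset_iff, singleton_subset_iff]
    exact ⟨h.subset _ (by simp), g.e₁₁.mem₄, h.subset _ (by simp)⟩

theorem two_le_dim : 2 ≤ dim cl (cl {a, b, c} ∩ cl {a, b, c'}) := by
  refine le_dim fun Y hY => ?_
  by_contra! hlt
  have hY1 : Y.encard ≤ 1 := Order.le_of_lt_succ hlt
  rw [encard_le_one_iff_subsingleton] at hY1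
  obtain ⟨y, hy⟩ : ∃ y, Y ⊆ {y} := by
    rcases hY1.eq_empty_or_singleton with rfl | ⟨y, rfl⟩
    · exact ⟨a, empty_subset _⟩
    · exact ⟨y, Subset.rfl⟩
  have hab : ∀ z ∈ ({a, b} : Set X), z ∈ cl {y} := fun z hz =>
    h.mono hy (hY ⟨h.subset _ (by rcases hz with rfl | rfl <;> simp), h.subset _ (by rcases hz with rfl | rfl <;> simp)⟩)
  exact g.not_mem h (p := y) (q := c) (r := a') (s := c') (h.mono (by simp) (hab a (by simp)))
    (h.mono (by simp) (hab b (by simp))) (h.subset _ (by simp)) (h.subset _ (by simp))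
    (h.subset _ (by simp))

theorem dim_inter_ne_top : dim cl (cl {a, b, c} ∩ cl {a, b, c'}) ≠ ⊤ := by
  refine ne_top_of_le_ne_top ?_ (dim_le_encard (Y := {a, b}) (toFinite _)
    (fun z hz => ⟨h.subset _ (by rcases hz with rfl | rfl <;> simp), h.subset _ (by rcases hz with rfl | rfl <;> simp)⟩) (g.inter_subset h))
  exact (toFinite _).encard_lt_top.ne

theorem two_le_toNat_dim : 2 ≤ (dim cl (cl {a, b, c} ∩ cl {a, b, c'})).toNat := by
  have h2 := g.two_le_dim h
  have ht := g.dim_inter_ne_top h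
  rw [← ENat.natCast_toNat ht] at h2
  exact_mod_cast h2

/-- Disjointness of the spans of adjacent pairs, when there are no circuits of size three. -/
theorem dim_eq_zero (h3 : ∀ x y z, x ∈ cl {y, z} → x ∈ cl {y} ∨ x ∈ cl {z}) {A : Set X}
    (hab : A ⊆ cl {a, b}) (hcd : A ⊆ cl {c, d}) : dim cl A = 0 := by
  -- A common point outside cl ∅ would be interdependent with p, and so put p in cl {q}.
  have hpt : ∀ {x p q : X}, p ∉ cl {q} → x ∈ cl {p} → x ∈ cl {q} → x ∈ cl ∅ := by
    intro x p q hpq hxp hxq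
    by_contra hx
    have := h.exchange (A := ∅) (y := p) (by simpa using hxp) hx
    exact hpq (h.cl_subset (singleton_subset_iff.2 hxq) (by simpa using this))
  have hA : A ⊆ cl ∅ := by
    intro x hx
    rcases h3 x a b (hab hx) with h1 | h1 <;> rcases h3 x c d (hcd hx) with h2 | h2
    · exact hpt (g.notMem_first h) h1 h2
    · exact hpt (g.swap.flip.swap.notMem_first h) h1 h2
    · exact hpt (g.flip.notMem_first h) h1 h2
    · exact hpt (g.flip.swap.flip.swap.notMem_first h) h1 h2
  simpa using dim_le_encard (cl := cl) (Y := ∅) (by simp) (empty_subset A) hA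

theorem five_le_dim {A : Set X} (hA : {a, b, a', b', c, d, c', d'} ⊆ A) : 5 ≤ dim cl A := by
  refine le_dim fun Y hY => ?_
  by_contra! hlt
  have h4 : Y.encard ≤ 4 := Order.le_of_lt_succ hlt
  have hfin : Y.Finite := finite_of_encard_le_coe h4
  obtain ⟨p, q, r, s, hs⟩ : ∃ p q r s, Y ⊆ {p, q, r, s} := by
    classical
    lift Y to Finset X using hfin
    rw [encard_coe_eq_coe_finsetCard] at h4
    have h4 : Y.card ≤ 4 := by exact_mod_cast h4
    have hx : ∀ k, k < 5 → Y.card = k → ∃ p q r s, (Y : Set X) ⊆ {p, q, r, s} := by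
      intro k hk hYk
      interval_cases k
      · rw [Finset.card_eq_zero] at hYk
        subst hYk
        exact ⟨a, a, a, a, by simp⟩
      · obtain ⟨p, rfl⟩ := Finset.card_eq_one.1 hYk
        exact ⟨p, p, p, p, by simp⟩
      · obtain ⟨p, q, -, rfl⟩ := Finset.card_eq_two.1 hYk
        exact ⟨p, q, q, q, by simp⟩
      · obtain ⟨p, q, r, -, -, -, rfl⟩ := Finset.card_eq_three.1 hYk
        exact ⟨p, q, r, r, by simp⟩
      · obtain ⟨p, q, r, s, -, -, -, -, -, -, rfl⟩ := Finset.card_eq_four.1 hYk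
        exact ⟨p, q, r, s, by simp⟩
    exact hx _ (by omega) rfl
  exact g.not_span p q r s ((hA.trans hY).trans (h.mono hs))

omit h g in
theorem _root_.Pregeom.flatSum_four (E : Fin 4 → Set X) (D : Set X → ℤ)
    (hD : ∀ A, D A = ((dim cl A).toNat : ℤ)) :
    flatSum cl E = D (E 0) + D (E 1) + D (E 2) + D (E 3)
      - D (E 0 ∩ E 1) - D (E 0 ∩ E 2) - D (E 0 ∩ E 3) - D (E 1 ∩ E 2) - D (E 1 ∩ E 3)
      - D (E 2 ∩ E 3)
      + D (E 0 ∩ (E 1 ∩ E 2)) + D (E 0 ∩ (E 1 ∩ E 3)) + D (E 0 ∩ (E 2 ∩ E 3))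
      + D (E 1 ∩ (E 2 ∩ E 3)) - D (E 0 ∩ (E 1 ∩ (E 2 ∩ E 3))) := by
  have hs : (Finset.univ.filter fun s : Finset (Fin 4) => s.Nonempty) =
      {{0}, {1}, {2}, {3}, {0, 1}, {0, 2}, {0, 3}, {1, 2}, {1, 3}, {2, 3},
        {0, 1, 2}, {0, 1, 3}, {0, 2, 3}, {1, 2, 3}, {0, 1, 2, 3}} := by decide
  unfold flatSum
  simp only [← hD]
  rw [hs]
  repeat rw [Finset.sum_insert (by decide)]
  rw [Finset.sum_singleton]
  simp
  ring

/-- A grid contradicts flatness. -/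
theorem not_flat (h3 : ∀ x y z, x ∈ cl {y, z} → x ∈ cl {y} ∨ x ∈ cl {z}) : ¬ Flat cl := by
  rintro ⟨-, hflat⟩
  let E : Fin 4 → Set X := ![cl {a, b, c}, cl {a, b, c'}, cl {a', b', c}, cl {a', b', c'}]
  have hfin : ∀ x y z : X, dim cl (cl {x, y, z}) ≠ ⊤ := fun x y z =>
    ne_top_of_le_ne_top (toFinite _).encard_lt_top.ne
      (dim_le_encard (toFinite {x, y, z}) (h.subset _) Subset.rfl)
  have key := hflat 4 E fun i => by
    fin_cases i <;> exact ⟨h.idem _, hfin _ _ _⟩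
  rw [flatSum_four E (fun A => ((dim cl A).toNat : ℤ)) fun _ => rfl] at key
  have e₁₁ := g.cl_eq h
  have e₁₂ := g.symm₂.cl_eq h
  have e₂₁ := g.symm₁.cl_eq h
  have e₂₂ := g.symm₂.symm₁.cl_eq h
  have r1 := g.inter_subset h
  have r2 := g.symm₁.inter_subset h
  have c1 := g.swap.inter_subset h
  have c2 := g.symm₂.swap.inter_subset h
  have p1 := g.two_le_toNat_dim h
  have p2 := g.symm₁.two_le_toNat_dim h
  have p3 := g.swap.two_le_toNat_dim h
  have p4 := g.symm₂.swap.two_le_toNat_dim h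
  rw [← e₁₁, ← e₂₁] at c1 p3
  rw [← e₁₂, ← e₂₂] at c2 p4
  -- Any three of the four sets include two sharing a row pair and two sharing a column pair.
  have z1 := g.dim_eq_zero h h3 (A := E 0 ∩ (E 1 ∩ E 2)) (fun x hx => r1 ⟨hx.1, hx.2.1⟩)
    fun x hx => c1 ⟨hx.1, hx.2.2⟩
  have z2 := g.symm₂.dim_eq_zero h h3 (A := E 0 ∩ (E 1 ∩ E 3)) (fun x hx => r1 ⟨hx.1, hx.2.1⟩)
    fun x hx => c2 ⟨hx.2.1, hx.2.2⟩
  have z3 := g.symm₁.dim_eq_zero h h3 (A := E 0 ∩ (E 2 ∩ E 3)) (fun x hx => r2 ⟨hx.2.1, hx.2.2⟩)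
    fun x hx => c1 ⟨hx.1, hx.2.1⟩
  have z4 := g.symm₁.symm₂.dim_eq_zero h h3 (A := E 1 ∩ (E 2 ∩ E 3))
    (fun x hx => r2 ⟨hx.2.1, hx.2.2⟩) fun x hx => c2 ⟨hx.1, hx.2.2⟩
  have d1 := h.toNat_dim_le_three a b c
  have d2 := h.toNat_dim_le_three a b c'
  have d3 := h.toNat_dim_le_three a' b' c
  have d4 := h.toNat_dim_le_three a' b' c'
  have hE0 : E 0 = cl {a, b, c} := rfl
  have hE1 : E 1 = cl {a, b, c'} := rfl
  have hE2 : E 2 = cl {a', b', c} := rfl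
  have hE3 : E 3 = cl {a', b', c'} := rfl
  rw [← hE0] at d1 p1 p3
  rw [← hE1] at d2 p1 p4
  rw [← hE2] at d3 p2 p3
  rw [← hE3] at d4 p2 p4
  have hmem : ∀ x i, x ∈ E i → x ∈ ⋃ i, E i := fun x i hx => mem_iUnion.2 ⟨i, hx⟩
  have haU : a ∈ ⋃ i, E i := hmem a 0 (h.subset _ (by simp))
  have hbU : b ∈ ⋃ i, E i := hmem b 0 (h.subset _ (by simp))
  have hcU : c ∈ ⋃ i, E i := hmem c 0 (h.subset _ (by simp))
  have hdU : d ∈ ⋃ i, E i := hmem d 0 g.e₁₁.mem₄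
  have haU' : a' ∈ ⋃ i, E i := hmem a' 2 (h.subset _ (by simp))
  have hbU' : b' ∈ ⋃ i, E i := hmem b' 2 (h.subset _ (by simp))
  have hcU' : c' ∈ ⋃ i, E i := hmem c' 1 (h.subset _ (by simp))
  have hdU' : d' ∈ ⋃ i, E i := hmem d' 1 g.e₁₂.mem₄
  have h5 : 5 ≤ dim cl (⋃ i, E i) := g.five_le_dim h (by
    simp only [insert_subset_iff, singleton_subset_iff]
    exact ⟨haU, hbU, haU', hbU', hcU, hdU, hcU', hdU'⟩)
  -- Finiteness matters because `toNat` sends `⊤` to 0.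
  have hne : dim cl (⋃ i, E i) ≠ ⊤ := by
    have hsp := g.subset_cl h (F := {a, b, c, a', c'}) (h.subset _ (by simp))
      (h.subset _ (by simp)) (h.subset _ (by simp)) (h.subset _ (by simp)) (h.subset _ (by simp))
    refine ne_top_of_le_ne_top (toFinite ({a, b, c, a', c'} : Set X)).encard_lt_top.ne
      (dim_le_encard (toFinite _) ?_ (iUnion_subset fun i => ?_))
    · simp only [insert_subset_iff, singleton_subset_iff]
      exact ⟨haU, hbU, hcU, haU', hcU'⟩
    · fin_cases i <;>
      · refine h.cl_subset fun x hx => hsp ?_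
        revert hx x
        simp
  rw [← ENat.natCast_toNat hne] at h5
  have h5 : 5 ≤ (dim cl (⋃ i, E i)).toNat := by exact_mod_cast h5
  rw [z1, z2, z3, z4] at key
  simp only [ENat.toNat_zero] at key
  -- The diagonal intersections and the fourfold one enter with a minus sign, so nonnegativity is
  -- enough for them.
  omega

end Grid

end Pregeom

/-! ### Consequences of the smallest circuit having size four -/

namespace Pregeom

open Set

variable {X : Type w} {cl : Set X → Set X}

/-- If there are no circuits of size three, then pairs span nothing new. -/
theorem SmallestCircuitDim.mem_cl_pair (hn : SmallestCircuitDim cl 3) (h : IsPregeom cl)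
    (x y z : X) (hx : x ∈ cl {y, z}) : x ∈ cl {y} ∨ x ∈ cl {z} := by
  by_contra! hcon
  obtain ⟨hxy, hxz⟩ := hcon
  have hyz : y ∉ cl {z} := fun hy =>
    hxz (h.cl_subset (by simpa [insert_subset_iff] using ⟨hy, h.subset {z} rfl⟩) hx)
  have hzy : z ∉ cl {y} := fun hz =>
    hxy (h.cl_subset (by simpa [insert_subset_iff] using ⟨h.subset {y} rfl, hz⟩) hx)
  have hyx : y ∉ cl {x} := fun hy => hxy <| by
    have := h.exchange (A := ∅) (x := y) (y := x) (by simpa using hy)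
      fun h0 => hyz (h.mono (empty_subset _) h0)
    simpa using this
  have hzx : z ∉ cl {x} := fun hz => hxz <| by
    have := h.exchange (A := ∅) (x := z) (y := x) (by simpa using hz)
      fun h0 => hzy (h.mono (empty_subset _) h0)
    simpa using this
  let f : Fin 3 → X := ![x, y, z]
  have hpair : ∀ i j : Fin 3, i ≠ j → f i ∉ cl {f j} := by
    intro i j hij
    fin_cases i <;> fin_cases j <;> first | exact absurd rfl hij | assumption
  have hcirc : IsCircuit cl f := by
    constructor
    · intro hind
      refine hind 0 (h.mono ?_ hx)
      simp only [insert_subset_iff, singleton_subset_iff]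
      exact ⟨⟨1, by simp, rfl⟩, ⟨2, by simp, rfl⟩⟩
    · intro s hs i hi
      obtain ⟨k, hk⟩ := (ne_univ_iff_exists_notMem s).1 hs
      have hik : (i : Fin 3) ≠ k := fun e => hk (e ▸ i.2)
      obtain ⟨l, hl, hl'⟩ : ∃ l, l ≠ (i : Fin 3) ∧ ∀ j, j ≠ k → j ≠ i → j = l := by
        have : ∀ i k : Fin 3, i ≠ k → ∃ l, l ≠ i ∧ ∀ j, j ≠ k → j ≠ i → j = l := by decide
        exact this _ _ hik
      refine hpair i l hl.symm (h.mono ?_ hi)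
      rintro _ ⟨j, hj, rfl⟩
      exact congrArg f (hl' j (fun e => hk (e ▸ j.2)) fun e => hj (Subtype.ext e))
  have := hn.2 ⟨by norm_num, f, hcirc⟩
  omega

theorem SmallestCircuitDim.exists_edge (hn : SmallestCircuitDim cl 3) (h : IsPregeom cl) :
    ∃ a b c d, Edge cl a b c d ∧ a ∉ cl ∅ ∧ b ∉ cl {a} ∧ c ∉ cl {a, b} := by
  obtain ⟨-, f, hdep, hind⟩ := hn.1
  have hf : ∀ i j k : Fin 4, j ≠ i → k ≠ i → f i ∉ cl {f j, f k} := by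
    intro i j k hj hk hi
    obtain ⟨l, hli, hlj, hlk⟩ : ∃ l, l ≠ i ∧ l ≠ j ∧ l ≠ k := by
      have : ∀ i j k : Fin 4, ∃ l, l ≠ i ∧ l ≠ j ∧ l ≠ k := by decide
      exact this i j k
    refine hind {i, j, k} (fun e => ?_) ⟨i, by simp⟩ (h.mono ?_ hi)
    · have : l ∈ ({i, j, k} : Set (Fin 4)) := e ▸ mem_univ l
      simp [hli, hlj, hlk] at this
    · simp only [insert_subset_iff, singleton_subset_iff]
      exact ⟨⟨⟨j, by simp⟩, fun e => hj (congrArg Subtype.val e), rfl⟩,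
        ⟨⟨k, by simp⟩, fun e => hk (congrArg Subtype.val e), rfl⟩⟩
  simp only [IndepTuple, not_forall, not_not] at hdep
  obtain ⟨i, hi⟩ := hdep
  obtain ⟨j, k, l, hji, hki, hli, hjk, hjl, hkl, hm⟩ : ∃ j k l : Fin 4, j ≠ i ∧ k ≠ i ∧ l ≠ i ∧
      j ≠ k ∧ j ≠ l ∧ k ≠ l ∧ ∀ m, m ≠ i → m = j ∨ m = k ∨ m = l := by
    have : ∀ i : Fin 4, ∃ j k l : Fin 4, j ≠ i ∧ k ≠ i ∧ l ≠ i ∧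
      j ≠ k ∧ j ≠ l ∧ k ≠ l ∧ ∀ m, m ≠ i → m = j ∨ m = k ∨ m = l := by decide
    exact this i
  have hd : f i ∈ cl {f j, f k, f l} := by
    refine h.mono ?_ hi
    rintro _ ⟨m, hmi, rfl⟩
    rcases hm m hmi with rfl | rfl | rfl <;> simp
  refine ⟨f j, f k, f l, f i, ⟨?_, ?_, ?_, hd⟩, ?_, ?_, ?_⟩
  · have := h.exchange (A := {f k, f l}) hd (hf i k l hki hli)
    exact mem_congr (by ext; simp only [mem_insert_iff, mem_singleton_iff]; tauto) this
  · have := h.exchange (A := {f j, f l}) (y := f k)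
      (mem_congr (by ext; simp only [mem_insert_iff, mem_singleton_iff]; tauto) hd)
      (hf i j l hji hli)
    exact mem_congr (by ext; simp only [mem_insert_iff, mem_singleton_iff]; tauto) this
  · have := h.exchange (A := {f j, f k}) (y := f l)
      (mem_congr (by ext; simp only [mem_insert_iff, mem_singleton_iff]; tauto) hd)
      (hf i j k hji hki)
    exact mem_congr (by ext; simp only [mem_insert_iff, mem_singleton_iff]; tauto) this
  · exact fun h0 => hf j k l hjk.symm hjl.symm (h.mono (empty_subset _) h0)
  · exact fun h0 => hf k j l hjk hkl.symm (h.mono (by simp) h0)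
  · exact hf l j k hjl hkl

end Pregeom

/-! ### From a 4-circuit to a grid -/

namespace StrMin

open Set FirstOrder.Language Pregeom

variable {L : FirstOrder.Language.{u, v}} {M : Type w} [L.Structure M]

theorem IsMinimal.isPregeom (hM : IsMinimal L M) : IsPregeom (acl L : Set M → Set M) where
  mono := acl_mono
  subset := subset_acl
  idem := acl_acl
  exchange := hM.exchange

/-- Substitute elements of `A` for some of the variables. -/
theorem Dfn.specialize {α β : Type} {A : Set M} {P : (α → M) → Prop} (hP : Dfn L A P)
    (f : α → β ⊕ A) : Dfn L A fun v : β → M => P fun i => Sum.elim v (fun z : A => (z : M)) (f i) := by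
  obtain ⟨φ, hφ⟩ := definable_iff_exists_formula_sum.1 hP
  refine definable_iff_exists_formula_sum.2
    ⟨φ.relabel (Sum.elim Sum.inl fun i => (f i).swap), ?_⟩
  ext v
  have e : (Sum.elim (fun z : A => (z : M)) v ∘ Sum.elim Sum.inl fun i => (f i).swap) =
      Sum.elim (fun z : A => (z : M)) fun i => Sum.elim v (fun z : A => (z : M)) (f i) := by
    funext z
    rcases z with z | i
    · rfl
    · rcases hfi : f i with j | z <;> simp [hfi]
  rw [mem_ofPred_eq, mem_ofPred_eq, Formula.realize_relabel, e]
  exact Set.ext_iff.1 hφ _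

theorem Dfn.specialize_last {A : Set M} {Q : M → M → M → M → Prop}
    (hQ : Dfn L ∅ fun v : Fin 4 → M => Q (v 0) (v 1) (v 2) (v 3)) {a b c : M} (ha : a ∈ A)
    (hb : b ∈ A) (hc : c ∈ A) : Dfn L A fun w : Fin 1 → M => Q a b c (w 0) :=
  (hQ.mono (empty_subset A)).specialize
    ![Sum.inr ⟨a, ha⟩, Sum.inr ⟨b, hb⟩, Sum.inr ⟨c, hc⟩, Sum.inl 0]

/-- Bounding the number of solutions inside the formula makes it witness algebraicity at every
quadruple where it holds, not only at the given one. -/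
theorem exists_relation_of_mem_acl {a b c d : M} (hd : d ∈ acl L {a, b, c}) :
    ∃ Q : M → M → M → M → Prop, (Dfn L ∅ fun v : Fin 4 → M => Q (v 0) (v 1) (v 2) (v 3)) ∧
      Q a b c d ∧ ∀ a b c d, Q a b c d → d ∈ acl L {a, b, c} := by
  rw [← insert_empty_eq c] at hd
  obtain ⟨R, hR, hRf, hRd⟩ := mem_acl.1 hd
  obtain ⟨Q₁, hQ₁, e₁⟩ := hR.exists_of_insert
  obtain ⟨Q₂, hQ₂, e₂⟩ := hQ₁.exists_of_insert
  obtain ⟨Q₃, hQ₃, e₃⟩ := hQ₂.exists_of_insert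
  let Q : M → M → M → M → Prop := fun a b c d => Q₃ c (cons b (cons a fun _ => d))
  have hRQ : ∀ x, R x ↔ Q a b c x := fun x =>
    (e₁ fun _ => x).trans ((e₂ (cons a fun _ => x)).trans (e₃ (cons b (cons a fun _ => x))))
  have hQ : Dfn L ∅ fun v : Fin 4 → M => Q (v 0) (v 1) (v 2) (v 3) := by
    have := hQ₃.comp (β := Fin 4) fun o =>
      o.elim 2 fun o => o.elim 1 fun o => o.elim 0 fun _ => 3
    have e : ∀ v : Fin 4 → M, cons (v 1) (cons (v 0) fun _ : Fin 1 => v 3) =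
        fun i : Option (Option (Fin 1)) => v (i.elim 1 fun o => o.elim 0 fun _ => 3) := by
      intro v
      funext o
      rcases o with _ | _ | i <;> rfl
    simp only [Q, e]
    exact this
  simp only [hRQ] at hRf hRd
  obtain ⟨n, hn⟩ : ∃ n : ℕ, {x | Q a b c x}.encard = n := ⟨_, hRf.encard_eq_coe_toFinset_card⟩
  have hQ' : Dfn L ∅ fun v : Fin 4 → M => Q (v 0) (v 1) (v 2) (v 3) ∧
      {x | Q (v 0) (v 1) (v 2) x}.encard ≤ n :=
    hQ.and (Dfn.encard_le (P := fun x (v : Fin 4 → M) => Q (v 0) (v 1) (v 2) x)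
      (hQ.comp ![some 0, some 1, some 2, none]) n)
  refine ⟨fun a b c d => Q a b c d ∧ {x | Q a b c x}.encard ≤ n, hQ', ⟨hRd, hn.le⟩, ?_⟩
  rintro a b c d ⟨hd, hle⟩
  exact mem_acl_of_finite (P := fun d => Q a b c d)
    (hQ.specialize_last (by simp) (by simp) (by simp)) (finite_of_encard_le_coe hle) hd

theorem exists_relation_of_edge {a b c d : M} (e : Edge (acl L) a b c d) :
    ∃ Q : M → M → M → M → Prop, (Dfn L ∅ fun v : Fin 4 → M => Q (v 0) (v 1) (v 2) (v 3)) ∧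
      Q a b c d ∧ ∀ a b c d, Q a b c d → Edge (acl L) a b c d := by
  obtain ⟨Q₁, hQ₁, h₁, k₁⟩ := exists_relation_of_mem_acl e.mem₁
  obtain ⟨Q₂, hQ₂, h₂, k₂⟩ := exists_relation_of_mem_acl e.mem₂
  obtain ⟨Q₃, hQ₃, h₃, k₃⟩ := exists_relation_of_mem_acl e.mem₃
  obtain ⟨Q₄, hQ₄, h₄, k₄⟩ := exists_relation_of_mem_acl e.mem₄
  refine ⟨fun a b c d => Q₁ b c d a ∧ Q₂ a c d b ∧ Q₃ a b d c ∧ Q₄ a b c d,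
    (hQ₁.comp ![1, 2, 3, 0]).and ((hQ₂.comp ![0, 2, 3, 1]).and ((hQ₃.comp ![0, 1, 3, 2]).and hQ₄)),
    ⟨h₁, h₂, h₃, h₄⟩, fun a b c d hQ => ?_⟩
  exact ⟨k₁ _ _ _ _ hQ.1, k₂ _ _ _ _ hQ.2.1, k₃ _ _ _ _ hQ.2.2.1, k₄ _ _ _ _ hQ.2.2.2⟩

/-- If a definable relation `Q` is solvable in its last variable at a generic triple, then for
every generic `a` and all but finitely many `b` it is solvable at `(a, b, c)` for generic `c`. -/
theorem IsMinimal.finite_setOf_not_solvable (hM : IsMinimal L M) {Q : M → M → M → M → Prop}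
    (hQ : Dfn L ∅ fun v : Fin 4 → M => Q (v 0) (v 1) (v 2) (v 3)) {a₀ b₀ c₀ d₀ : M}
    (ha₀ : a₀ ∉ acl L (∅ : Set M)) (hb₀ : b₀ ∉ acl L {a₀}) (hc₀ : c₀ ∉ acl L {a₀, b₀})
    (h₀ : Q a₀ b₀ c₀ d₀) {a : M} (ha : a ∉ acl L (∅ : Set M)) :
    {b | ¬ ∀ c, c ∉ acl L {a, b} → ∃ d, Q a b c d}.Finite := by
  let P : M → M → M → Prop := fun a b c => ∃ d, Q a b c d
  have hP : Dfn L ∅ fun v : Fin 3 → M => P (v 0) (v 1) (v 2) :=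
    Dfn.ex (P := fun d v => Q (v 0) (v 1) (v 2) d) (hQ.comp ![some 0, some 1, some 2, none])
  have hPab : ∀ a b : M, Dfn L {a, b} fun w : Fin 1 → M => P a b (w 0) := fun a b =>
    (hP.mono (empty_subset {a, b})).specialize
      ![Sum.inr ⟨a, by simp⟩, Sum.inr ⟨b, by simp⟩, Sum.inl 0]
  obtain ⟨n, hn⟩ : ∃ n : ℕ, {c | ¬ P a₀ b₀ c}.encard = n :=
    ⟨_, (hM.compl_finite (P := fun c => P a₀ b₀ c) (hPab a₀ b₀) hc₀
      ⟨d₀, h₀⟩).encard_eq_coe_toFinset_card⟩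
  -- "For generic c" and "for generic b" become bounds on the number of exceptions. These are
  -- first-order, so they pass from a₀ to a.
  let θ : M → M → Prop := fun a b => {c | ¬ P a b c}.encard ≤ n
  have hθ : Dfn L ∅ fun v : Fin 2 → M => θ (v 0) (v 1) :=
    Dfn.encard_le (P := fun c v => ¬ P (v 0) (v 1) c) (hP.comp ![some 0, some 1, none]).not n
  have hθa : Dfn L {a₀} fun w : Fin 1 → M => θ a₀ (w 0) :=
    (hθ.mono (empty_subset {a₀})).specialize ![Sum.inr ⟨a₀, by simp⟩, Sum.inl 0]
  obtain ⟨m, hm⟩ : ∃ m : ℕ, {b | ¬ θ a₀ b}.encard = m :=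
    ⟨_, (hM.compl_finite (P := fun b => θ a₀ b) hθa hb₀ hn.le).encard_eq_coe_toFinset_card⟩
  have hη : Dfn L ∅ fun v : Fin 1 → M => {b | ¬ θ (v 0) b}.encard ≤ m :=
    Dfn.encard_le (P := fun b v => ¬ θ (v 0) b) (hθ.comp ![some 0, none]).not m
  have hηa : {b | ¬ θ a b}.encard ≤ m :=
    hM.transfer (P := fun a => {b | ¬ θ a b}.encard ≤ m) hη ha₀ hm.le ha
  refine (finite_of_encard_le_coe hηa).subset fun b hb hθb => hb fun c hc => ?_
  by_contra hPc
  exact hc (mem_acl_of_finite (P := fun c => ¬ P a b c) (hPab a b).not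
    (finite_of_encard_le_coe hθb) hPc)

/-- If generic points have infinite algebraic closure and pairs span nothing new, then a circuit
of size four yields a grid. -/
theorem IsMinimal.exists_grid (hM : IsMinimal L M)
    (hgen : ∀ A : Set M, A.Finite → ∃ x, x ∉ acl L A)
    (h3 : ∀ x y z : M, x ∈ acl L {y, z} → x ∈ acl L {y} ∨ x ∈ acl L {z})
    (hinf : ∀ a : M, a ∉ acl L (∅ : Set M) → (acl L {a}).Infinite) {a₀ b₀ c₀ d₀ : M}
    (e : Edge (acl L) a₀ b₀ c₀ d₀) (ha₀ : a₀ ∉ acl L (∅ : Set M)) (hb₀ : b₀ ∉ acl L {a₀})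
    (hc₀ : c₀ ∉ acl L {a₀, b₀}) :
    ∃ a b a' b' c d c' d' : M, Grid (acl L) a b a' b' c d c' d' := by
  have h := hM.isPregeom
  obtain ⟨Q, hQ, h₀, hQe⟩ := exists_relation_of_edge e
  obtain ⟨a, ha⟩ := hgen ∅ finite_empty
  obtain ⟨a', ha'⟩ := hgen {a} (toFinite _)
  obtain ⟨c, hc⟩ := hgen {a', a} (toFinite _)
  obtain ⟨c', hc'⟩ := hgen {c, a', a} (toFinite _)
  let B : M → Prop := fun b =>
    ∃ d d' b', Q a b c d ∧ Q a b c' d' ∧ Q a' b' c d ∧ Q a' b' c' d'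
  have hB : Dfn L {c', c, a', a} fun w : Fin 1 → M => B (w 0) := by
    have h5 : Dfn L {c', c, a', a} fun v : Fin 5 → M => ∃ d d' b', Q (v 0) (v 1) (v 2) d ∧
        Q (v 0) (v 1) (v 3) d' ∧ Q (v 4) b' (v 2) d ∧ Q (v 4) b' (v 3) d' := by
      refine Dfn.mono ?_ (empty_subset _)
      refine Dfn.ex (P := fun d (v : Fin 5 → M) => ∃ d' b', Q (v 0) (v 1) (v 2) d ∧
        Q (v 0) (v 1) (v 3) d' ∧ Q (v 4) b' (v 2) d ∧ Q (v 4) b' (v 3) d') ?_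
      refine Dfn.ex (P := fun d' (v : Option (Fin 5) → M) => ∃ b',
        Q (v (some 0)) (v (some 1)) (v (some 2)) (v none) ∧
        Q (v (some 0)) (v (some 1)) (v (some 3)) d' ∧
        Q (v (some 4)) b' (v (some 2)) (v none) ∧ Q (v (some 4)) b' (v (some 3)) d') ?_
      refine Dfn.ex (P := fun b' (v : Option (Option (Fin 5)) → M) =>
        Q (v (some (some 0))) (v (some (some 1))) (v (some (some 2))) (v (some none)) ∧
        Q (v (some (some 0))) (v (some (some 1))) (v (some (some 3))) (v none) ∧
        Q (v (some (some 4))) b' (v (some (some 2))) (v (some none)) ∧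
        Q (v (some (some 4))) b' (v (some (some 3))) (v none)) ?_
      let s : Fin 5 → Option (Option (Option (Fin 5))) := fun i => some (some (some i))
      exact (hQ.comp ![s 0, s 1, s 2, some (some none)]).and
        ((hQ.comp ![s 0, s 1, s 3, some none]).and
          ((hQ.comp ![s 4, none, s 2, some (some none)]).and
            (hQ.comp ![s 4, none, s 3, some none])))
    exact h5.specialize ![Sum.inr ⟨a, by simp⟩, Sum.inl 0, Sum.inr ⟨c, by simp⟩,
      Sum.inr ⟨c', by simp⟩, Sum.inr ⟨a', by simp⟩]
  have hac : c ∉ acl L {a} := fun hh => hc (acl_mono (by simp) hh)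
  have hac' : c' ∉ acl L {a} := fun hh => hc' (acl_mono (by simp) hh)
  have hexch : ∀ {A : Set M} {x y : M}, x ∉ acl L A → y ∉ acl L (insert x A) →
      x ∉ acl L (insert y A) := by
    intro A x y hx hy hxy
    exact hy (h.exchange hxy hx)
  have hacc : a ∉ acl L {c, c'} := by
    have h1 : a ∉ acl L (insert c ∅) := hexch ha (by simpa using hac)
    have h2 : a ∉ acl L (insert c' (insert c ∅)) := hexch h1 fun hh => hc' (acl_mono (by
      simp [insert_subset_iff]) hh)
    exact fun hh => h2 (acl_mono (by simp [insert_subset_iff]) hh)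
  have hacc' : a' ∉ acl L {c, c'} := by
    have h1 : a' ∉ acl L (insert c {a}) := hexch ha' hc
    have h2 : a' ∉ acl L (insert c' (insert c {a})) := hexch h1 fun hh => hc' (acl_mono (by
      simp [insert_subset_iff]) hh)
    exact fun hh => h2 (acl_mono (by simp [insert_subset_iff]) hh)
  have hsol := hM.finite_setOf_not_solvable hQ ha₀ hb₀ hc₀ h₀ ha
  have hBinf : {b | B b}.Infinite := by
    refine ((hinf a ha).sdiff hsol).mono ?_
    rintro b ⟨hba, hb⟩
    have hb : ∀ c, c ∉ acl L {a, b} → ∃ d, Q a b c d := not_not.1 hb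
    have hab : acl L {a, b} ⊆ acl L {a} := h.cl_subset (by
      simpa [insert_subset_iff] using ⟨h.subset {a} rfl, hba⟩)
    have key : ∀ {c d}, c ∉ acl L {a} → Q a b c d → d ∈ acl L {c} := by
      intro c d hc hQd
      have hd : d ∈ acl L {a, c} := h.cl_subset (by
        simp only [insert_subset_iff, singleton_subset_iff]
        exact ⟨h.subset _ (by simp), h.mono (by simp) hba, h.subset _ (by simp)⟩) (hQe _ _ _ _ hQd).mem₄
      -- If d were in acl(a), then b and d both would be, and the edge would put c there too.
      refine (h3 _ _ _ hd).resolve_left fun hda => hc ?_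
      refine h.cl_subset ?_ (hQe _ _ _ _ hQd).mem₃
      simp only [insert_subset_iff, singleton_subset_iff]
      exact ⟨h.subset _ (by simp), hba, hda⟩
    obtain ⟨d, hd⟩ := hb c fun hh => hac (hab hh)
    obtain ⟨d', hd'⟩ := hb c' fun hh => hac' (hab hh)
    have hcl : acl L {c, d, c', d'} ⊆ acl L {c, c'} := h.cl_subset (by
      simp only [insert_subset_iff, singleton_subset_iff]
      exact ⟨h.subset _ (by simp), h.mono (by simp) (key hac hd), h.subset _ (by simp),
        h.mono (by simp) (key hac' hd')⟩)
    -- Quantifying b away leaves only parameters in acl(c, c'), over which a and a' are both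
    -- generic.
    have hR : Dfn L {c, d, c', d'} fun w : Fin 1 → M => ∃ y, Q (w 0) y c d ∧ Q (w 0) y c' d' := by
      refine Dfn.ex (P := fun y (w : Fin 1 → M) => Q (w 0) y c d ∧ Q (w 0) y c' d') ?_
      have hQ' := hQ.mono (empty_subset {c, d, c', d'})
      exact (hQ'.specialize ![Sum.inl (some 0), Sum.inl none, Sum.inr ⟨c, by simp⟩,
        Sum.inr ⟨d, by simp⟩]).and (hQ'.specialize ![Sum.inl (some 0), Sum.inl none,
        Sum.inr ⟨c', by simp⟩, Sum.inr ⟨d', by simp⟩])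
    obtain ⟨b', hb'⟩ := hM.transfer (P := fun x => ∃ y, Q x y c d ∧ Q x y c' d') hR
      (fun hh => hacc (hcl hh)) ⟨b, hd, hd'⟩ (fun hh => hacc' (hcl hh))
    exact ⟨d, d', b', hd, hd', hb'⟩
  obtain ⟨b, hb⟩ := hgen {c', c, a', a} (toFinite _)
  have hBb : B b := by
    by_contra hBb
    have := (hM.2 {b | B b} (hB.mono (subset_univ _))).resolve_left hBinf
    exact hb (mem_acl_of_finite hB.not this hBb)
  obtain ⟨d, d', b', q₁₁, q₁₂, q₂₁, q₂₂⟩ := hBb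
  refine ⟨a, b, a', b', c, d, c', d', hQe _ _ _ _ q₁₁, hQe _ _ _ _ q₁₂, hQe _ _ _ _ q₂₁,
    hQe _ _ _ _ q₂₂, fun p q r s hs => ?_⟩
  have hl : IndepList (acl L) (∅ : Set M) [a, a', c, c', b] := by
    simpa [IndepList] using ⟨ha, ha', hc, hc', hb⟩
  have := h.length_le_encard [a, a', c, c', b] (Y := {p, q, r, s}) hl fun x hx => by
    rw [empty_union]
    refine hs ?_
    simp only [List.mem_cons, List.not_mem_nil, or_false] at hx
    rcases hx with rfl | rfl | rfl | rfl | rfl <;> simp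
  have h4 : ({p, q, r, s} : Set M).encard ≤ 4 := by
    refine (encard_insert_le _ _).trans ?_
    refine (add_le_add_left ((encard_insert_le _ _).trans
      (add_le_add_left (encard_insert_le _ _) 1)) 1).trans ?_
    rw [encard_singleton]
    norm_num
  exact absurd (this.trans h4) (by norm_num)

/-- Realize the type of all cofinite formulas over A, finitely satisfiable because M is infinite. -/
theorem IsOmegaSaturated.exists_notMem_acl (hsat : IsOmegaSaturated L M) [Infinite M] (A : Set M)
    (hA : A.Finite) : ∃ x, x ∉ acl L A := by
  obtain ⟨x, hx⟩ := hsat A hA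
    {φ : L[[A]].Formula (Fin 1) | {x : M | ¬ φ.Realize fun _ => x}.Finite} fun q hq hqf => by
      have : (⋃ φ ∈ q, {x : M | ¬ φ.Realize fun _ => x}).Finite := hqf.biUnion fun φ hφ => hq hφ
      obtain ⟨x, hx⟩ := this.infinite_compl.nonempty
      exact ⟨x, by simpa using hx⟩
  refine ⟨x, fun hxA => ?_⟩
  obtain ⟨P, ⟨φ, hφ⟩, hf, hPx⟩ := mem_acl.1 hxA
  have hPφ : ∀ y, P y ↔ φ.Realize fun _ => y := fun y => Set.ext_iff.1 hφ fun _ => y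
  have := hx φ.not (by simpa [hPφ] using hf)
  rw [Formula.realize_not, ← hPφ] at this
  exact this hPx

/-! ### Sizes of closures, transfer between models, and the conclusion -/

theorem exists_finite_dfn {A t : Set M} (ht : t.Finite) (htA : t ⊆ acl L A) :
    ∃ P : M → Prop, (Dfn L A fun v : Fin 1 → M => P (v 0)) ∧ {x | P x}.Finite ∧ ∀ x ∈ t, P x := by
  induction t, ht using Set.Finite.induction_on with
  | empty => exact ⟨fun _ => False, definable_empty, by simp, by simp⟩
  | @insert y t _ _ ih =>
    rw [insert_subset_iff] at htA
    obtain ⟨P, hP, hPf, hPt⟩ := ih htA.2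
    obtain ⟨R, hR, hRf, hRy⟩ := mem_acl.1 htA.1
    refine ⟨fun x => P x ∨ R x, hP.or hR, hPf.union hRf, ?_⟩
    rintro x (rfl | hx)
    · exact Or.inr hRy
    · exact Or.inl (hPt x hx)

/-- If s is algebraic, its closure is acl ∅. Otherwise s has the type of a, and n + 1 points of
acl(s) lie in one finite definable set whose size bounds hold for a as well. -/
theorem IsMinimal.encard_acl_le (hM : IsMinimal L M) {a s : M} (ha : a ∉ acl L (∅ : Set M))
    {n : ℕ} (hn : (acl L {a}).encard ≤ n) : (acl L {s}).encard ≤ n := by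
  by_cases hs : s ∈ acl L (∅ : Set M)
  · refine (encard_le_encard ?_).trans hn
    exact (hM.isPregeom.cl_subset (singleton_subset_iff.2 hs)).trans (acl_mono (empty_subset _))
  by_contra! hlt
  obtain ⟨t, hts, htn⟩ := exists_subset_encard_eq (Order.add_one_le_of_lt hlt)
  have htf : t.Finite := finite_of_encard_le_coe (k := n + 1) (by rw [htn]; norm_cast)
  rw [← insert_empty_eq s] at hts
  obtain ⟨P, hP, hPf, hPt⟩ := exists_finite_dfn htf hts
  obtain ⟨Q, hQ, hPQ⟩ := hP.exists_of_insert
  have hPQ : ∀ x, P x ↔ Q s fun _ => x := fun x => hPQ fun _ => x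
  simp only [hPQ] at hPf hPt
  obtain ⟨k, hk⟩ : ∃ k : ℕ, {x | Q s fun _ => x}.encard = k :=
    ⟨_, hPf.encard_eq_coe_toFinset_card⟩
  have hQ2 : Dfn L ∅ fun w : Fin 2 → M => Q (w 0) fun _ => w 1 :=
    hQ.comp fun o => o.elim 0 fun _ => 1
  have hQ1 : Dfn L ∅ fun w : Option (Fin 1) → M => Q (w (some 0)) fun _ => w none :=
    hQ2.comp ![some 0, none]
  obtain ⟨h1, h2⟩ := hM.transfer (P := fun a => ((n + 1 : ℕ) : ℕ∞) ≤ {x | Q a fun _ => x}.encard ∧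
      {x | Q a fun _ => x}.encard ≤ k)
    ((Dfn.le_encard (P := fun x w => Q (w 0) fun _ => x) hQ1 (n + 1)).and
      (Dfn.encard_le (P := fun x w => Q (w 0) fun _ => x) hQ1 k)) hs
    ⟨by
      push_cast
      rw [← htn]
      exact encard_le_encard hPt, hk.le⟩ ha
  have hQa : Dfn L {a} fun w : Fin 1 → M => Q a fun _ => w 0 :=
    (hQ2.mono (empty_subset {a})).specialize ![Sum.inr ⟨a, by simp⟩, Sum.inl 0]
  have hsub : {x | Q a fun _ => x} ⊆ acl L {a} := fun x hx =>
    mem_acl_of_finite (P := fun x => Q a fun _ => x) hQa (finite_of_encard_le_coe h2) hx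
  have := (h1.trans (encard_le_encard hsub)).trans hn
  have : n + 1 ≤ n := by exact_mod_cast this
  omega

/-- Infinitude of the algebraic closure of a pair transfers between models of a complete theory. -/
theorem exists_le_encard_acl {T : L.Theory} (hT : T.IsComplete) [M ⊨ T] (N : Type w)
    [L.Structure N] [N ⊨ T] [Nonempty N] {y₁ y₂ : M} (hinf : (acl L {y₁, y₂}).Infinite) (m : ℕ) :
    ∃ s₁ s₂ : N, (m : ℕ∞) ≤ (acl L {s₁, s₂}).encard := by
  classical
  have : Nonempty M := ⟨y₁⟩
  obtain ⟨t, hts, htm⟩ := hinf.exists_subset_card_eq m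
  obtain ⟨P, hP, hPf, hPt⟩ := exists_finite_dfn t.finite_toSet hts
  obtain ⟨φ, hφ⟩ := definable_iff_exists_formula_sum.1 hP
  let χ : L.Formula (Option (Fin 2)) := φ.relabel
    -- Testing against y₁ also covers the case y₁ = y₂.
    (Sum.elim (fun z : ({y₁, y₂} : Set M) => if (z : M) = y₁ then some 0 else some 1) fun _ => none)
  have hχ : ∀ x, P x ↔ χ.Realize (cons x ![y₁, y₂]) := by
    intro x
    have e : (cons x ![y₁, y₂] ∘ Sum.elim
        (fun z : ({y₁, y₂} : Set M) => if (z : M) = y₁ then some 0 else some 1)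
        fun _ : Fin 1 => none) = Sum.elim (fun z : ({y₁, y₂} : Set M) => (z : M)) fun _ => x := by
      funext z
      rcases z with ⟨z, hz⟩ | i
      · by_cases hz1 : z = y₁
        · simp [hz1]
        · have hz2 : z = y₂ := hz.resolve_left hz1
          simp [hz1, hz2.symm]
      · rfl
    rw [Formula.realize_relabel, e]
    exact Set.ext_iff.1 hφ fun _ => x
  simp only [hχ] at hPf hPt
  obtain ⟨k, hk⟩ : ∃ k : ℕ, {x | χ.Realize (cons x ![y₁, y₂])}.encard = k :=
    ⟨_, hPf.encard_eq_coe_toFinset_card⟩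
  obtain ⟨ψ₁, hψ₁⟩ := exists_formula_le_encard.{_, _, w} m χ
  obtain ⟨ψ₂, hψ₂⟩ := exists_formula_le_encard.{_, _, w} (k + 1) χ
  -- The upper bound k keeps the solution set finite in the other model, so its points are algebraic
  -- there.
  let σ : L.Sentence := ((ψ₁ ⊓ ψ₂.not).relabel (Sum.inr : Fin 2 → Empty ⊕ Fin 2)).iExs (Fin 2)
  have hσ : ∀ (K : Type w) [L.Structure K], K ⊨ σ ↔ ∃ v : Fin 2 → K,
      (m : ℕ∞) ≤ {x | χ.Realize (cons x v)}.encard ∧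
        ¬ ((k + 1 : ℕ) : ℕ∞) ≤ {x | χ.Realize (cons x v)}.encard := by
    intro K _
    rw [Sentence.Realize, Formula.realize_iExs]
    refine exists_congr fun v => ?_
    rw [Formula.realize_relabel, Formula.realize_inf, Formula.realize_not, Sum.elim_comp_inr,
      hψ₁, hψ₂]
  have hMσ : M ⊨ σ := by
    rw [hσ]
    refine ⟨![y₁, y₂], ?_, ?_⟩
    · rw [← htm, ← encard_coe_eq_coe_finsetCard]
      exact encard_le_encard hPt
    · rw [hk]
      norm_cast
      omega
  rw [hT.realize_sentence_iff, ← hT.realize_sentence_iff σ N, hσ] at hMσ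
  obtain ⟨v, hv₁, hv₂⟩ := hMσ
  refine ⟨v 0, v 1, hv₁.trans (encard_le_encard fun x hx => ?_)⟩
  have hd : Dfn L (∅ : Set N) fun w : Option (Fin 2) → N => χ.Realize w :=
    empty_definable_iff.2 ⟨χ, rfl⟩
  have hfin : {x | χ.Realize (cons x v)}.Finite :=
    finite_of_encard_le_coe (k := k + 1) (le_of_lt (by simpa using hv₂))
  refine mem_acl_of_finite (P := fun x => χ.Realize (cons x v)) ?_ hfin hx
  have := (hd.mono (empty_subset {v 0, v 1})).specialize (β := Fin 1)
    fun o => o.elim (Sum.inl 0) ![Sum.inr ⟨v 0, by simp⟩, Sum.inr ⟨v 1, by simp⟩]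
  convert this using 3 with w
  funext o
  rcases o with _ | i
  · rfl
  · fin_cases i <;> rfl

theorem exists_acl_pair_eq_univ [Nonempty M] (h : modelDim L M < 3) :
    ∃ y₁ y₂ : M, acl L {y₁, y₂} = univ := by
  simp only [modelDim, dim, iInf_lt_iff] at h
  obtain ⟨Y, hY, hlt⟩ := h
  have hY : IsBasisFor (acl L) (univ : Set M) Y := hY
  have hY2 : Y.encard ≤ 2 := Order.le_of_lt_succ hlt
  obtain ⟨y₁, y₂, hs⟩ : ∃ y₁ y₂, Y ⊆ {y₁, y₂} := by
    rcases hY2.lt_or_eq with hlt | heq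
    · have hY1 : Y.encard ≤ 1 := Order.le_of_lt_succ hlt
      rcases (encard_le_one_iff_subsingleton.1 hY1).eq_empty_or_singleton with rfl | ⟨y, rfl⟩
      · exact ⟨Classical.arbitrary M, Classical.arbitrary M, empty_subset _⟩
      · exact ⟨y, y, by simp⟩
    · obtain ⟨y₁, y₂, -, rfl⟩ := encard_eq_two.1 heq
      exact ⟨y₁, y₂, Subset.rfl⟩
  exact ⟨y₁, y₂, univ_subset_iff.1 (hY.prop.2.trans (acl_mono hs))⟩

theorem three_le_modelDim {T : L.Theory} (hT : IsStronglyMinimal.{u, v, w} T)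
    (S : Type w) [L.Structure S] [S ⊨ T] (hS : IsOmegaSaturated L S)
    (hflat : Flat (acl L : Set S → Set S))
    (hn : SmallestCircuitDim (acl L : Set S → Set S) 3) (M : Type w) [L.Structure M] [M ⊨ T] :
    3 ≤ modelDim L M := by
  by_contra! hlt
  have hSm : IsMinimal L S := hT.2 S
  have := hSm.1
  have := (hT.2 M).1
  have h := hSm.isPregeom
  obtain ⟨y₁, y₂, hy⟩ := exists_acl_pair_eq_univ hlt
  have h3 := hn.mem_cl_pair h
  obtain ⟨a₀, b₀, c₀, d₀, e, ha₀, hb₀, hc₀⟩ := hn.exists_edge h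
  have hinf : ∀ a : S, a ∉ acl L (∅ : Set S) → (acl L {a}).Infinite := by
    intro a ha hfin
    obtain ⟨n, hn⟩ : ∃ n : ℕ, (acl L {a}).encard = n := ⟨_, hfin.encard_eq_coe_toFinset_card⟩
    -- A pair's closure is a union of two closures of size at most n, so one more than 2n is a
    -- contradiction.
    obtain ⟨s₁, s₂, hs⟩ := exists_le_encard_acl hT.1 S (hy ▸ infinite_univ) (n + n + 1)
    have hsub : acl L {s₁, s₂} ⊆ acl L {s₁} ∪ acl L {s₂} := fun x hx => h3 x s₁ s₂ hx
    have := (hs.trans (encard_le_encard hsub)).trans ((encard_union_le _ _).trans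
      (add_le_add (hSm.encard_acl_le ha hn.le) (hSm.encard_acl_le ha hn.le)))
    have : n + n + 1 ≤ n + n := by exact_mod_cast this
    omega
  obtain ⟨a, b, a', b', c, d, c', d', g⟩ :=
    hSm.exists_grid hS.exists_notMem_acl h3 hinf e ha₀ hb₀ hc₀
  exact g.not_flat h h3 hflat

end StrMin

theorem mainTheorem9 {L : FirstOrder.Language.{u, v}} [Countable L.Symbols] (T : L.Theory)
    (hT : StrMin.IsStronglyMinimal.{u, v, w} T)
    -- the countable saturated model of `T`, whose pregeometry is the pregeometry of `T`
    (S : Type w) [L.Structure S] [S ⊨ T] [Countable S] (hS : StrMin.IsOmegaSaturated L S)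
    (hflat : Pregeom.Flat (StrMin.acl L : Set S → Set S))
    (hn : Pregeom.SmallestCircuitDim (StrMin.acl L : Set S → Set S) 3) :
    (∀ (P : Type w) [L.Structure P], StrMin.IsPrimeModel T P → 3 ≤ StrMin.modelDim L P) ∧
      (∀ (M : Type w) [L.Structure M] [M ⊨ T], StrMin.modelDim L M ≠ 2) := by
  refine ⟨fun P _ hP => ?_, fun M _ _ h2 => ?_⟩
  · have := hP.1
    exact StrMin.three_le_modelDim hT S hS hflat hn P
  · have := StrMin.three_le_modelDim hT S hS hflat hn M
    rw [h2] at this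
    exact absurd this (by norm_num)
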